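/- Let $K$ be a field. A braided vector space is a $K$-vector space $V$ with a $K$-linear map $c:V\otimes V\to V\otimes V$ (not assumed invertible) satisfying $(c\otimes V)(V\otimes c)(c\otimes V)=(V\otimes c)(c\otimes V)(V\otimes c)$. Let $T(V,c)$ be the braided tensor algebra, that is the tensor algebra $T(V)$ with the braiding extending $c$, with counit zero on $V$ and with the comultiplication $T(V)\to T(V)\otimes_c T(V)$ determined by $v\mapsto v\otimes 1+1\otimes v$. For a braided bialgebra $B$ put $P(B)=\{x\in B:\Delta(x)=x\otimes 1+1\otimes x\}$. A bracket $b=(b^{[n]})_{n\ge 0}$ for $(V,c)$ consists of braided bialgebras $U^{[n]}$, with canonical maps $i^{[n]}:V\to P^{[n]}:=P(U^{[n]})$ and $V^{[n]}:=i^{[n]}(V)$, and of linear maps $b^{[n]}:P^{[n]}\to V$, such that $U^{[0]}=T(V,c)$, $U^{[n+1]}$ is the quotient braided bialgebra of $U^{[n]}$ by the two-sided ideal generated by $\{p-i^{[n]}b^{[n]}(p):p\in P^{[n]}\}$, and $$c_{V^{[n]}}(i^{[n]}b^{[n]}\otimes V^{[n]})=(V^{[n]}\otimes i^{[n]}b^{[n]})\,c_{P^{[n]},V^{[n]}},\qquad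 c_{V^{[n]}}(V^{[n]}\otimes i^{[n]}b^{[n]})=(i^{[n]}b^{[n]}\otimes V^{[n]})\,c_{V^{[n]},P^{[n]}},$$ where the maps $c$ with subscripts are restrictions of the braiding of $U^{[n]}$. Let $U=U(V,c,b)$ be the direct limit of $U^{[0]}\to U^{[1]}\to\cdots$, with canonical projection $\pi_U:T(V,c)\to U$. One calls $(V,c,b)$ a braided Lie algebra if $\pi_U$ is injective on $V$. The Nichols algebra $\mathcal B(V,c)$, with canonical projection $\Omega:T(V,c)\to\mathcal B(V,c)$, is the direct limit of $S^{[0]}\to S^{[1]}\to\cdots$, where $S^{[0]}=T(V,c)$ and $S^{[n+1]}$ is the quotient of $S^{[n]}$ by the two-sided ideal generated by the homogeneous primitive elements of degree at least two. It is graded, with components $\mathcal B(V,c)^n=\Omega(V^{\otimes n})$; let $\Omega^n:V^{\otimes n}\to\mathcal B(V,c)^n$ be the $n$th component of $\Omega$. The standard filtration of $U$ is $U_{(n)}=\pi_U(\bigoplus_{i=0}^n V^{\otimes i})$, with $U_{(-1)}=0$. Its associated graded braided bialgebra is $\mathfrak G(U)=\bigoplus_n U_{(n)}/U_{(n-1)}$,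 and $\vartheta_U:T(V,c)\to\mathfrak G(U)$ is the algebra homomorphism that sends $v\in V$ to $\pi_U(v)+U_{(0)}\in U_{(1)}/U_{(0)}$. One says that $U$ is of PBW type if there is an isomorphism of braided bialgebras $\omega_U:\mathcal B(V,c)\to\mathfrak G(U)$ with $\omega_U\circ\Omega=\vartheta_U$. **Proposition.** Let $(V,c,b)$ be a braided Lie algebra such that $U=U(V,c,b)$ is of PBW type. 1. Let $n\ge 0$ and let $W_n\subseteq V^{\otimes n}$ be a subspace such that $\Omega^n|_{W_n}:W_n\to\mathcal B(V,c)^n$ is an isomorphism. Then $U_{(n)}=U_{(n-1)}\oplus\pi_U(W_n)$, and $\pi_U|_{W_n}$ is injective. 2. Let $\Theta=\{n\ge 0:\mathcal B(V,c)^n\ne 0\}$, and for each $n\in\Theta$ let $(v_{n,i})_{i\in I_n}$ be a linearly independent family in $V^{\otimes n}$ whose span $W_n$ is mapped isomorphically onto $\mathcal B(V,c)^n$ by $\Omega^n$. Then $(\pi_U(v_{n,i}))_{n\in\Theta,\,i\in I_n}$ is a basis of $U$. -/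

import Mathlib

open TensorProduct

namespace BraidedLie

/-- The quantum Yang-Baxter equation `c₁ c₂ c₁ = c₂ c₁ c₂` on `(V ⊗ V) ⊗ V`, where
`c₁ = c ⊗ V` and `c₂ = V ⊗ c`. The map `c` is not required to be invertible. -/
def IsBraiding {K W : Type*} [Field K] [AddCommGroup W] [Module K W]
    (c : W ⊗[K] W →ₗ[K] W ⊗[K] W) : Prop :=
  let c₁ : (W ⊗[K] W) ⊗[K] W →ₗ[K] (W ⊗[K] W) ⊗[K] W := c.rTensor W
  let c₂ : (W ⊗[K] W) ⊗[K] W →ₗ[K] (W ⊗[K] W) ⊗[K] W :=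
    (TensorProduct.assoc K W W W).symm.toLinearMap ∘ₗ c.lTensor W ∘ₗ
      (TensorProduct.assoc K W W W).toLinearMap
  c₁ ∘ₗ c₂ ∘ₗ c₁ = c₂ ∘ₗ c₁ ∘ₗ c₂

/-- The structure maps which, besides the algebra structure, make up a braided bialgebra. -/
structure BraidedOps (K A : Type*) [Field K] [Ring A] [Algebra K A] where
  comul : A →ₗ[K] A ⊗[K] A
  counit : A →ₗ[K] K
  braid : A ⊗[K] A →ₗ[K] A ⊗[K] A

/-- An algebra homomorphism is a morphism of braided bialgebras if it commutes with
comultiplications, counits and braidings. -/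
structure BraidedOps.IsHom {K A B : Type*} [Field K] [Ring A] [Algebra K A] [Ring B] [Algebra K B]
    (H : BraidedOps K A) (L : BraidedOps K B) (f : A →ₐ[K] B) : Prop where
  comul : L.comul ∘ₗ f.toLinearMap = TensorProduct.map f.toLinearMap f.toLinearMap ∘ₗ H.comul
  counit : L.counit ∘ₗ f.toLinearMap = H.counit
  braid : L.braid ∘ₗ TensorProduct.map f.toLinearMap f.toLinearMap =
    TensorProduct.map f.toLinearMap f.toLinearMap ∘ₗ H.braid

/-- The space `P(A)` of primitive elements, `Δ(a) = a ⊗ 1 + 1 ⊗ a`. -/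
def BraidedOps.primitives {K A : Type*} [Field K] [Ring A] [Algebra K A] (H : BraidedOps K A) :
    Submodule K A :=
  LinearMap.eqLocus H.comul ((TensorProduct.mk K A A).flip 1 + TensorProduct.mk K A A 1)

section Induced

variable {K M N P : Type*} [Field K] [AddCommGroup M] [Module K M] [AddCommGroup N] [Module K N]
  [AddCommGroup P] [Module K P]

open Classical in
/-- The map `k : N → P` induced by `g : M → P` on the image `N` of a surjection `f : M → N`, that is
the unique `k` with `k ∘ f = g`, if `g` vanishes on the kernel of `f` (and `0` otherwise). -/
noncomputable def induced (f : M →ₗ[K] N) (g : M →ₗ[K] P) : N →ₗ[K] P :=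
  if h : ∃ k : N →ₗ[K] P, k ∘ₗ f = g then h.choose else 0

theorem induced_comp {f : M →ₗ[K] N} {g : M →ₗ[K] P} (hf : Function.Surjective f)
    (h : LinearMap.ker f ≤ LinearMap.ker g) : induced f g ∘ₗ f = g := by
  have h' : ∃ k : N →ₗ[K] P, k ∘ₗ f = g := by
    refine ⟨(LinearMap.ker f).liftQ g h ∘ₗ (f.quotKerEquivOfSurjective hf).symm.toLinearMap, ?_⟩
    ext x
    simp [LinearMap.quotKerEquivOfSurjective_symm_apply]
  rw [induced, dif_pos h']
  exact h'.choose_spec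

end Induced

section Quotients

variable {K A : Type*} [Field K] [Ring A] [Algebra K A]

/-- The quotient of `A` by a two-sided ideal. -/
abbrev QuotAlg (I : TwoSidedIdeal A) : Type _ := A ⧸ I.asIdeal

variable (K) in
/-- The canonical projection `A → A ⧸ I`. -/
abbrev proj (I : TwoSidedIdeal A) : A →ₐ[K] QuotAlg I := Ideal.Quotient.mkₐ K I.asIdeal

/-- The structure maps which those of `A` induce on `A ⧸ I`. -/
noncomputable def BraidedOps.quot (H : BraidedOps K A) (I : TwoSidedIdeal A) :
    BraidedOps K (QuotAlg I) where
  comul := induced (proj K I).toLinearMap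
    (TensorProduct.map (proj K I).toLinearMap (proj K I).toLinearMap ∘ₗ H.comul)
  counit := induced (proj K I).toLinearMap H.counit
  braid := induced (TensorProduct.map (proj K I).toLinearMap (proj K I).toLinearMap)
    (TensorProduct.map (proj K I).toLinearMap (proj K I).toLinearMap ∘ₗ H.braid)

end Quotients

section Tensor

variable {K : Type*} [Field K] {V : Type*} [AddCommGroup V] [Module K V]
variable {X : Type*} [AddCommGroup X] [Module K X]

/-- The homogeneous component `V^{⊗ n}` of the tensor algebra. -/
def tensorPart (K V : Type*) [Field K] [AddCommGroup V] [Module K V] (n : ℕ) :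
    Submodule K (TensorAlgebra K V) :=
  LinearMap.range (TensorAlgebra.ι K : V →ₗ[K] TensorAlgebra K V) ^ n

/-- Given `δ : X ⊗ V → V ⊗ X`, an element `y : V` acts on `T(V) ⊗ X` by
`t ⊗ p ↦ (t ⊗ 1) δ(p ⊗ y)`. -/
def passGen (δ : X ⊗[K] V →ₗ[K] V ⊗[K] X) :
    V →ₗ[K] Module.End K (TensorAlgebra K V ⊗[K] X) :=
  (TensorProduct.curry
    ((LinearMap.mul' K (TensorAlgebra K V) ∘ₗ (TensorAlgebra.ι K).lTensor _).rTensor X ∘ₗ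
      (TensorProduct.assoc K _ V X).symm.toLinearMap ∘ₗ δ.lTensor _ ∘ₗ
      (TensorProduct.assoc K (TensorAlgebra K V) X V).toLinearMap)).flip

/-- The extension of `passGen` to a right action of `T(V)` on `T(V) ⊗ X`. -/
def pass (δ : X ⊗[K] V →ₗ[K] V ⊗[K] X) :
    TensorAlgebra K V →ₐ[K] (Module.End K (TensorAlgebra K V ⊗[K] X))ᵐᵒᵖ :=
  TensorAlgebra.lift K ((MulOpposite.opLinearEquiv K).toLinearMap ∘ₗ passGen δ)

/-- The extension of `δ : X ⊗ V → V ⊗ X` to `X ⊗ T(V) → T(V) ⊗ X`, which moves the letters of a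
tensor through `X` one after the other, beginning with the first one. -/
def braidXT (δ : X ⊗[K] V →ₗ[K] V ⊗[K] X) :
    X ⊗[K] TensorAlgebra K V →ₗ[K] TensorAlgebra K V ⊗[K] X :=
  TensorProduct.lift
    ((((MulOpposite.opLinearEquiv K).symm.toLinearMap ∘ₗ (pass δ).toLinearMap).flip) ∘ₗ
      TensorProduct.mk K (TensorAlgebra K V) X 1)

/-- Given `β : V ⊗ X → X ⊗ V`, the algebra `T(V)` acts on `X ⊗ T(V)`; a generator `x : V` acts by
`p ⊗ t ↦ β(x ⊗ p) (1 ⊗ t)`. -/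
def act (β : V ⊗[K] X →ₗ[K] X ⊗[K] V) :
    TensorAlgebra K V →ₐ[K] Module.End K (X ⊗[K] TensorAlgebra K V) :=
  TensorAlgebra.lift K (TensorProduct.curry
    ((LinearMap.mul' K (TensorAlgebra K V) ∘ₗ (TensorAlgebra.ι K).rTensor _).lTensor X ∘ₗ
      (TensorProduct.assoc K X V _).toLinearMap ∘ₗ β.rTensor _ ∘ₗ
      (TensorProduct.assoc K V X (TensorAlgebra K V)).symm.toLinearMap))

/-- The extension of `β : V ⊗ X → X ⊗ V` to `T(V) ⊗ X → X ⊗ T(V)`, which moves the letters of a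
tensor through `X` one after the other, beginning with the last one. -/
def braidTX (β : V ⊗[K] X →ₗ[K] X ⊗[K] V) :
    TensorAlgebra K V ⊗[K] X →ₗ[K] X ⊗[K] TensorAlgebra K V :=
  TensorProduct.lift
    ((act β).toLinearMap.flip ∘ₗ (TensorProduct.mk K X (TensorAlgebra K V)).flip 1).flip

/-- The braiding of the tensor algebra. -/
def tensorBraid (c : V ⊗[K] V →ₗ[K] V ⊗[K] V) :
    TensorAlgebra K V ⊗[K] TensorAlgebra K V →ₗ[K] TensorAlgebra K V ⊗[K] TensorAlgebra K V :=
  braidTX (braidXT c)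

/-- The action of `T(V)` on `T(V) ⊗ T(V)` in which `x : V` acts as left multiplication by
`x ⊗ 1 + 1 ⊗ x` in the algebra `T(V) ⊗_c T(V)`. -/
def comulAct (c : V ⊗[K] V →ₗ[K] V ⊗[K] V) :
    TensorAlgebra K V →ₐ[K] Module.End K (TensorAlgebra K V ⊗[K] TensorAlgebra K V) :=
  TensorAlgebra.lift K
    ((LinearMap.rTensorHom (TensorAlgebra K V) ∘ₗ LinearMap.mul K (TensorAlgebra K V)) ∘ₗ
      TensorAlgebra.ι K + (act (braidXT c)).toLinearMap ∘ₗ TensorAlgebra.ι K)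

/-- The structure maps of the braided tensor algebra `T(V, c)`. -/
def tensorOps (c : V ⊗[K] V →ₗ[K] V ⊗[K] V) : BraidedOps K (TensorAlgebra K V) where
  comul := (comulAct c).toLinearMap.flip (1 ⊗ₜ 1)
  counit := (TensorAlgebra.lift K (0 : V →ₗ[K] K)).toLinearMap
  braid := tensorBraid c

end Tensor

section Nichols

variable {K : Type*} [Field K] {V : Type*} [AddCommGroup V] [Module K V]

/-- The ideal `J` of `T(V, c)` for which the symmetric algebra `S^[n]` of rank `n` is `T(V, c) ⧸ J`:
one has `S^[0] = T(V, c)`, and `S^[n+1]` is the quotient of `S^[n]` by the two-sided ideal generated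
by the homogeneous primitive elements of degree at least two. -/
noncomputable def symIdeal (c : V ⊗[K] V →ₗ[K] V ⊗[K] V) : ℕ → TwoSidedIdeal (TensorAlgebra K V)
  | 0 => ⊥
  | n + 1 => (TwoSidedIdeal.span {z : QuotAlg (symIdeal c n) |
      z ∈ ((tensorOps c).quot (symIdeal c n)).primitives ∧
        ∃ k, 2 ≤ k ∧ z ∈ (tensorPart K V k).map (proj K (symIdeal c n)).toLinearMap}).comap
      (proj K (symIdeal c n))

/-- The kernel of the projection of `T(V, c)` onto the direct limit `S^[∞]` of the `S^[n]`. -/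
noncomputable def nicholsIdeal (c : V ⊗[K] V →ₗ[K] V ⊗[K] V) : TwoSidedIdeal (TensorAlgebra K V) :=
  ⨆ n, symIdeal c n

/-- The Nichols algebra `B(V, c) = S^[∞]`. -/
abbrev Nichols (c : V ⊗[K] V →ₗ[K] V ⊗[K] V) : Type _ := QuotAlg (nicholsIdeal c)

/-- The structure maps of the braided bialgebra `B(V, c)`. -/
noncomputable def nicholsOps (c : V ⊗[K] V →ₗ[K] V ⊗[K] V) : BraidedOps K (Nichols c) :=
  (tensorOps c).quot (nicholsIdeal c)

/-- The canonical projection `Ω : T(V, c) → B(V, c)`. -/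
noncomputable abbrev nicholsProj (c : V ⊗[K] V →ₗ[K] V ⊗[K] V) : TensorAlgebra K V →ₐ[K] Nichols c :=
  proj K (nicholsIdeal c)

/-- The homogeneous component `B(V, c)^n`. -/
noncomputable def nicholsPart (c : V ⊗[K] V →ₗ[K] V ⊗[K] V) (n : ℕ) : Submodule K (Nichols c) :=
  (tensorPart K V n).map (nicholsProj c).toLinearMap

/-- The set of all `n` with `B(V, c)^n ≠ 0`. -/
def nicholsSupport (c : V ⊗[K] V →ₗ[K] V ⊗[K] V) : Set ℕ := {n | nicholsPart c n ≠ ⊥}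

end Nichols

section Bracket

variable {K : Type*} [Field K] {V : Type*} [AddCommGroup V] [Module K V]

/-- The canonical map `V → T(V) ⧸ I`. -/
noncomputable def incl (I : TwoSidedIdeal (TensorAlgebra K V)) : V →ₗ[K] QuotAlg I :=
  (proj K I).toLinearMap ∘ₗ TensorAlgebra.ι K

/-- A bracket for the braided vector space `(V, c)`. The braided bialgebra `U^[n]` is the quotient of
`T(V, c)` by `ideal n`, `i^[n] = incl (ideal n) : V → U^[n]`, and `b n` is the map
`b^[n] : P^[n] → V` on the primitive elements `P^[n]` of `U^[n]`. -/
structure Bracket (c : V ⊗[K] V →ₗ[K] V ⊗[K] V) where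
  ideal : ℕ → TwoSidedIdeal (TensorAlgebra K V)
  b (n : ℕ) : ((tensorOps c).quot (ideal n)).primitives →ₗ[K] V
  /-- The structure maps of `T(V, c)` induce structure maps on `U^[n]`. -/
  isHom (n : ℕ) : (tensorOps c).IsHom ((tensorOps c).quot (ideal n)) (proj K (ideal n))
  /-- `U^[0] = T(V, c)`. -/
  ideal_zero : ideal 0 = ⊥
  /-- `U^[n+1]` is the quotient of `U^[n]` by the ideal generated by `(Id - i^[n] b^[n])(P^[n])`. -/
  ideal_succ (n : ℕ) : ideal (n + 1) =
    (TwoSidedIdeal.span (Set.range fun p : ((tensorOps c).quot (ideal n)).primitives =>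
      (p : QuotAlg (ideal n)) - incl (ideal n) (b n p))).comap
      (proj K (ideal n))
  /-- `c (i b ⊗ V^[n]) = (V^[n] ⊗ i b) c_{P, V}`, where `c_{P, V}` is the restriction
  `P^[n] ⊗ V^[n] → V^[n] ⊗ P^[n]` of the braiding of `U^[n]`. -/
  braid_left (n : ℕ) :
    let H := (tensorOps c).quot (ideal n)
    let P := H.primitives
    let V' := LinearMap.range (incl (ideal n))
    ∃ cPV : P ⊗[K] V' →ₗ[K] V' ⊗[K] P,
      TensorProduct.map V'.subtype P.subtype ∘ₗ cPV =
        H.braid ∘ₗ TensorProduct.map P.subtype V'.subtype ∧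
      H.braid ∘ₗ TensorProduct.map (incl (ideal n) ∘ₗ b n) V'.subtype =
        TensorProduct.map V'.subtype (incl (ideal n) ∘ₗ b n) ∘ₗ cPV
  /-- `c (V^[n] ⊗ i b) = (i b ⊗ V^[n]) c_{V, P}`, where `c_{V, P}` is the restriction
  `V^[n] ⊗ P^[n] → P^[n] ⊗ V^[n]` of the braiding of `U^[n]`. -/
  braid_right (n : ℕ) :
    let H := (tensorOps c).quot (ideal n)
    let P := H.primitives
    let V' := LinearMap.range (incl (ideal n))
    ∃ cVP : V' ⊗[K] P →ₗ[K] P ⊗[K] V',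
      TensorProduct.map P.subtype V'.subtype ∘ₗ cVP =
        H.braid ∘ₗ TensorProduct.map V'.subtype P.subtype ∧
      H.braid ∘ₗ TensorProduct.map V'.subtype (incl (ideal n) ∘ₗ b n) =
        TensorProduct.map (incl (ideal n) ∘ₗ b n) V'.subtype ∘ₗ cVP

namespace Bracket

variable {c : V ⊗[K] V →ₗ[K] V ⊗[K] V} (b : Bracket c)

/-- The kernel of the projection of `T(V, c)` onto the direct limit of the `U^[n]`. -/
def envIdeal : TwoSidedIdeal (TensorAlgebra K V) := ⨆ n, b.ideal n

/-- The universal enveloping algebra `U(V, c, b)`, the direct limit of the `U^[n]`. -/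
abbrev Env : Type _ := QuotAlg b.envIdeal

/-- The structure maps of the braided bialgebra `U(V, c, b)`. -/
noncomputable def envOps : BraidedOps K b.Env := (tensorOps c).quot b.envIdeal

/-- The canonical projection `π_U : T(V, c) → U(V, c, b)`. -/
abbrev envProj : TensorAlgebra K V →ₐ[K] b.Env := proj K b.envIdeal

/-- `(V, c, b)` is a braided Lie algebra if the canonical map `i_U : V → U(V, c, b)` is injective. -/
def IsBraidedLie : Prop := Function.Injective (incl b.envIdeal)

end Bracket

end Bracket

section Filtration

/-- An increasing algebra filtration indexed by `ℕ`. -/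
structure AlgFiltration (K B : Type*) [Field K] [Ring B] [Algebra K B] where
  part : ℕ → Submodule K B
  mono : Monotone part
  one_mem : 1 ∈ part 0
  mul_mem {m n : ℕ} {x y : B} (hx : x ∈ part m) (hy : y ∈ part n) : x * y ∈ part (m + n)

namespace AlgFiltration

variable {K B : Type*} [Field K] [Ring B] [Algebra K B] (F : AlgFiltration K B)

/-- The preceding part `F₍ₙ₋₁₎`, where `F₍₋₁₎ = 0`. -/
def prev : ℕ → Submodule K B
  | 0 => ⊥
  | n + 1 => F.part n

/-- The component `F₍ₙ₎ / F₍ₙ₋₁₎` of the associated graded algebra. -/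
def Gr (n : ℕ) : Type _ := F.part n ⧸ (F.prev n).submoduleOf (F.part n)

instance (n : ℕ) : AddCommGroup (F.Gr n) :=
  inferInstanceAs (AddCommGroup (F.part n ⧸ (F.prev n).submoduleOf (F.part n)))

instance (n : ℕ) : Module K (F.Gr n) :=
  inferInstanceAs (Module K (F.part n ⧸ (F.prev n).submoduleOf (F.part n)))

/-- The class of an element of `F₍ₙ₎` in `F₍ₙ₎ / F₍ₙ₋₁₎`. -/
def cls (n : ℕ) : F.part n →ₗ[K] F.Gr n := Submodule.mkQ _

theorem cls_surjective (n : ℕ) : Function.Surjective (F.cls n) := Submodule.mkQ_surjective _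

theorem mul_mem_prev_left {m n : ℕ} {x y : B} (hx : x ∈ F.prev m) (hy : y ∈ F.part n) :
    x * y ∈ F.prev (m + n) := by
  cases m with
  | zero => rw [(Submodule.mem_bot K).1 hx, zero_mul]; exact zero_mem _
  | succ m => rw [Nat.succ_add]; exact F.mul_mem hx hy

theorem mul_mem_prev_right {m n : ℕ} {x y : B} (hx : x ∈ F.part m) (hy : y ∈ F.prev n) :
    x * y ∈ F.prev (m + n) := by
  cases n with
  | zero => rw [(Submodule.mem_bot K).1 hy, mul_zero]; exact zero_mem _
  | succ n => exact F.mul_mem hx hy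

/-- The multiplication `F₍ₘ₎ × F₍ₙ₎ → F₍ₘ₊ₙ₎`. -/
def mulPart (m n : ℕ) : F.part m →ₗ[K] F.part n →ₗ[K] F.part (m + n) :=
  LinearMap.mk₂ K (fun x y => ⟨x * y, F.mul_mem x.2 y.2⟩)
    (fun _ _ _ => Subtype.ext (add_mul _ _ _)) (fun _ _ _ => Subtype.ext (smul_mul_assoc _ _ _))
    (fun _ _ _ => Subtype.ext (mul_add _ _ _)) (fun _ _ _ => Subtype.ext (mul_smul_comm _ _ _))

/-- The multiplication of homogeneous elements of the associated graded algebra. -/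
def mulGr (m n : ℕ) : F.Gr m →ₗ[K] F.Gr n →ₗ[K] F.Gr (m + n) :=
  Submodule.liftQ _ (LinearMap.flip (Submodule.liftQ _
    ((F.mulPart m n).compr₂ (F.cls (m + n))).flip (fun y hy => LinearMap.ext fun x =>
      (Submodule.Quotient.mk_eq_zero _).2 (F.mul_mem_prev_right x.2 hy)))) (fun x hx => by
    refine LinearMap.ext fun y => ?_
    obtain ⟨y, rfl⟩ := F.cls_surjective _ y
    exact (Submodule.Quotient.mk_eq_zero _).2 (F.mul_mem_prev_left hx y.2))

theorem gradedMk_ext {m n : ℕ} (h : m = n) {x : F.part m} {y : F.part n} (hxy : (x : B) = y) :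
    (GradedMonoid.mk m (F.cls m x) : GradedMonoid F.Gr) = GradedMonoid.mk n (F.cls n y) := by
  subst h
  rw [Subtype.ext hxy]

instance : GradedMonoid.GOne F.Gr where
  one := F.cls 0 ⟨1, F.one_mem⟩

instance : GradedMonoid.GMul F.Gr where
  mul x y := F.mulGr _ _ x y

instance : DirectSum.GRing F.Gr where
  mul_zero _ := map_zero _
  zero_mul y := LinearMap.congr_fun (map_zero (F.mulGr _ _)) y
  mul_add _ := map_add _
  add_mul x x' y := LinearMap.congr_fun (map_add (F.mulGr _ _) x x') y
  one_mul := by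
    rintro ⟨n, x⟩
    obtain ⟨x, rfl⟩ := F.cls_surjective _ x
    exact F.gradedMk_ext (zero_add n) (one_mul _)
  mul_one := by
    rintro ⟨n, x⟩
    obtain ⟨x, rfl⟩ := F.cls_surjective _ x
    exact F.gradedMk_ext (add_zero n) (mul_one _)
  mul_assoc := by
    rintro ⟨m, x⟩ ⟨n, y⟩ ⟨k, z⟩
    obtain ⟨x, rfl⟩ := F.cls_surjective _ x
    obtain ⟨y, rfl⟩ := F.cls_surjective _ y
    obtain ⟨z, rfl⟩ := F.cls_surjective _ z
    exact F.gradedMk_ext (add_assoc m n k) (mul_assoc _ _ _)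
  natCast n := n • F.cls 0 ⟨1, F.one_mem⟩
  natCast_zero := zero_smul _ _
  natCast_succ n := succ_nsmul _ n
  intCast n := n • F.cls 0 ⟨1, F.one_mem⟩
  intCast_ofNat n := natCast_zsmul _ n
  intCast_negSucc_ofNat n := negSucc_zsmul _ n

instance : DirectSum.GAlgebra K F.Gr where
  toFun := ((LinearMap.toSpanSingleton K (F.Gr 0) (F.cls 0 ⟨1, F.one_mem⟩)).toAddMonoidHom)
  map_one := one_smul K (F.cls 0 ⟨1, F.one_mem⟩)
  map_mul r s := by
    refine F.gradedMk_ext (m := 0) (n := 0 + 0) (x := (r * s) • ⟨1, F.one_mem⟩) 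
      (y := F.mulPart 0 0 (r • ⟨1, F.one_mem⟩) (s • ⟨1, F.one_mem⟩)) rfl ?_
    simp [mulPart, mul_smul]
    rw [smul_comm]
  commutes r := by
    rintro ⟨n, x⟩
    obtain ⟨x, rfl⟩ := F.cls_surjective _ x
    refine F.gradedMk_ext (m := 0 + n) (n := n + 0) (x := F.mulPart 0 n (r • ⟨1, F.one_mem⟩) x)
      (y := F.mulPart n 0 x (r • ⟨1, F.one_mem⟩)) (by simp) ?_
    simp [mulPart]
  smul_def r := by
    rintro ⟨n, x⟩
    obtain ⟨x, rfl⟩ := F.cls_surjective _ x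
    refine F.gradedMk_ext (m := n) (n := 0 + n) (x := r • x)
      (y := F.mulPart 0 n (r • ⟨1, F.one_mem⟩) x) (by simp) ?_
    simp [mulPart]


open scoped DirectSum

/-- The associated graded algebra `⨁ F₍ₙ₎ / F₍ₙ₋₁₎`. -/
abbrev Graded : Type _ := ⨁ n, F.Gr n

/-- A linear map `B → F₍ₙ₎ / F₍ₙ₋₁₎` that extends the projection of `F₍ₙ₎`. -/
noncomputable def extend (n : ℕ) : B →ₗ[K] F.Gr n := (LinearMap.exists_extend (F.cls n)).choose

/-- The map `extend` with values in the associated graded algebra. -/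
noncomputable def symbol (n : ℕ) : B →ₗ[K] F.Graded := DirectSum.lof K ℕ F.Gr n ∘ₗ F.extend n

/-- The map induced by `(pₙ ⊗ pₘ) c` on `Grₘ ⊗ Grₙ`. -/
noncomputable def gradedBraid (H : BraidedOps K B) (m n : ℕ) :
    F.Gr m ⊗[K] F.Gr n →ₗ[K] F.Graded ⊗[K] F.Graded :=
  induced (M := F.part m ⊗[K] F.part n) (TensorProduct.map (F.cls m) (F.cls n))
    (TensorProduct.map (F.symbol n) (F.symbol m) ∘ₗ H.braid ∘ₗ
      TensorProduct.map (F.part m).subtype (F.part n).subtype)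

/-- The structure maps which those of `B` induce on the associated graded algebra, provided that
`Δ(F₍ₙ₎) ⊆ ∑ F₍ᵢ₎ ⊗ F₍ₙ₋ᵢ₎` and `c(F₍ₘ₎ ⊗ F₍ₙ₎) ⊆ F₍ₙ₎ ⊗ F₍ₘ₎`. In this case
`∑ (pᵢ ⊗ pₙ₋ᵢ) Δ` on `F₍ₙ₎` and `(pₙ ⊗ pₘ) c` on `F₍ₘ₎ ⊗ F₍ₙ₎` do not depend on the choice of the
extensions `pᵢ : B → F₍ᵢ₎ / F₍ᵢ₋₁₎` of the projections. The counit is that of `B` in degree zero and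
vanishes in positive degrees. -/
noncomputable def gradedOps (H : BraidedOps K B) : BraidedOps K F.Graded where
  comul := DirectSum.toModule K ℕ _ fun n => induced (F.cls n)
    ((∑ ij ∈ Finset.HasAntidiagonal.antidiagonal n, TensorProduct.map (F.symbol ij.1) (F.symbol ij.2)) ∘ₗ
      H.comul ∘ₗ (F.part n).subtype)
  counit := DirectSum.toModule K ℕ _ fun n =>
    if n = 0 then induced (F.cls n) (H.counit ∘ₗ (F.part n).subtype) else 0
  braid := DirectSum.toModule K (ℕ × ℕ) _ (fun mn => F.gradedBraid H mn.1 mn.2) ∘ₗ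
    (TensorProduct.directSum K K F.Gr F.Gr).toLinearMap

end AlgFiltration

end Filtration

namespace Bracket

variable {K : Type*} [Field K] {V : Type*} [AddCommGroup V] [Module K V]
  {c : V ⊗[K] V →ₗ[K] V ⊗[K] V} (b : Bracket c)

/-- The standard filtration `U₍ₙ₎ = π_U (⨁_{i ≤ n} V^{⊗ i})` of `U = U(V, c, b)`. -/
def stdFiltration : AlgFiltration K b.Env where
  part n := (⨆ i, ⨆ (_ : i ≤ n), tensorPart K V i).map b.envProj.toLinearMap
  mono _ _ h := Submodule.map_mono (iSup₂_mono' fun i hi => ⟨i, le_trans hi h, le_rfl⟩)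
  one_mem := ⟨1, Submodule.mem_iSup_of_mem 0 (Submodule.mem_iSup_of_mem (le_refl 0)
    (Submodule.one_le.1 (pow_zero _).ge)), map_one b.envProj⟩
  mul_mem {m n x y} hx hy := by
    obtain ⟨x, hx, rfl⟩ := hx
    obtain ⟨y, hy, rfl⟩ := hy
    refine ⟨x * y, ?_, map_mul b.envProj x y⟩
    have h := Submodule.mul_mem_mul hx hy
    simp only [Submodule.iSup_mul, Submodule.mul_iSup] at h
    refine SetLike.le_def.1 (iSup₂_le fun i hi => ?_) h
    refine iSup₂_le fun j hj => ?_
    rw [tensorPart, tensorPart, ← pow_add]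
    exact le_iSup₂_of_le (j + i) (by omega) le_rfl

theorem incl_mem (v : V) : incl b.envIdeal v ∈ b.stdFiltration.part 1 :=
  ⟨TensorAlgebra.ι K v, Submodule.mem_iSup_of_mem 1 (Submodule.mem_iSup_of_mem (le_refl 1)
    ((pow_one (LinearMap.range (TensorAlgebra.ι K : V →ₗ[K] TensorAlgebra K V))).ge ⟨v, rfl⟩)), rfl⟩

/-- The braided bialgebra homomorphism `ϑ_U : T(V, c) → 𝔊(U)` that sends `v` in `V` to the class
of `π_U(v)` in `U₍₁₎ / U₍₀₎`. -/
noncomputable def theta : TensorAlgebra K V →ₐ[K] b.stdFiltration.Graded :=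
  TensorAlgebra.lift K (DirectSum.lof K ℕ b.stdFiltration.Gr 1 ∘ₗ b.stdFiltration.cls 1 ∘ₗ
    (incl b.envIdeal).codRestrict (b.stdFiltration.part 1) b.incl_mem)

/-- `U = U(V, c, b)` is of PBW type if `ϑ_U` factors through an isomorphism
`ω_U : B(V, c) → 𝔊(U)` of braided bialgebras. -/
def IsPBWType : Prop :=
  ∃ ω : Nichols c →ₐ[K] b.stdFiltration.Graded, Function.Bijective ω ∧
    (nicholsOps c).IsHom (b.stdFiltration.gradedOps b.envOps) ω ∧
    ω.comp (nicholsProj c) = b.theta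

end Bracket

end BraidedLie

namespace BraidedLie

open TensorProduct

/-! ### Independence in a filtered algebra. -/

namespace AlgFiltration

variable {K B : Type*} [Field K] [Ring B] [Algebra K B] (F : AlgFiltration K B)

/-! PBW type transports the kernel of `Ω` to the filtration of `U`. On `V^{⊗ n}` the map `ϑ_U` is
`π_U` followed by passage to the class modulo `U₍ₙ₋₁₎` (`theta_apply`). Since `ϑ_U = ω ∘ Ω` with `ω`
injective, a tensor `x` of degree `n` satisfies `Ω x = 0` exactly when `π_U x` drops to `U₍ₙ₋₁₎`
(`IsPBWType.nicholsProj_eq_zero_iff`). So if `Ω` maps `W ⊆ V^{⊗ n}` bijectively onto `B(V, c)^n`,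
then `π_U(W)` is a complement of `U₍ₙ₋₁₎` in `U₍ₙ₎`: surjectivity gives the sum, injectivity gives
the trivial intersection and the injectivity of `π_U` on `W`.

The basis is assembled from these complements. Independence across degrees comes from the top term
of a relation (`iSupIndep_of_disjoint_prev`), and spanning from induction along the filtration,
which exhausts `U`. -/

theorem cls_eq_zero_iff {n : ℕ} (x : F.part n) : F.cls n x = 0 ↔ (x : B) ∈ F.prev n :=
  Submodule.Quotient.mk_eq_zero _

theorem part_le_prev {m n : ℕ} (h : m < n) : F.part m ≤ F.prev n := by
  cases n with
  | zero => exact absurd h m.not_lt_zero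
  | succ n => exact F.mono (Nat.lt_succ_iff.1 h)

/-- Subspaces of the `F₍ₙ₎` that meet the `F₍ₙ₋₁₎` trivially are independent. -/
theorem iSupIndep_of_disjoint_prev {s : Set ℕ} {p : s → Submodule K B}
    (hp : ∀ n : s, p n ≤ F.part n) (hd : ∀ n : s, Disjoint (F.prev n) (p n)) :
    iSupIndep p := by
  rw [iSupIndep_iff_finsetSum_eq_zero_imp_eq_zero]
  intro t v
  -- The largest index `m` is split off: all other terms then lie in `F.prev m`, which forces the
  -- term of index `m` to vanish.
  induction t using Finset.induction_on_max with
  | empty => simp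
  | insert m t hm ih =>
    intro hv h
    have hvt : ∀ i ∈ t, v i ∈ p i := fun i hi => hv i (Finset.mem_insert_of_mem hi)
    rw [Finset.sum_insert fun h => lt_irrefl _ (hm m h)] at h
    have hsum : ∑ i ∈ t, v i ∈ F.prev m :=
      sum_mem fun i hi => F.part_le_prev (hm i hi) (hp i (hvt i hi))
    have hvm : v m = 0 := Submodule.disjoint_def.1 (hd m) _
      (by rw [eq_neg_of_add_eq_zero_left h]; exact neg_mem hsum)
      (hv m (Finset.mem_insert_self _ _))
    rw [hvm, zero_add] at h
    intro i hi
    rcases Finset.mem_insert.1 hi with rfl | hi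
    · exact hvm
    · exact ih hvt h i hi

end AlgFiltration

/-! ### The standard filtration and the map `ϑ_U`. -/

namespace Bracket

variable {K : Type*} [Field K] {V : Type*} [AddCommGroup V] [Module K V]
  {c : V ⊗[K] V →ₗ[K] V ⊗[K] V} (b : Bracket c)

theorem envProj_mem_part {n : ℕ} {x : TensorAlgebra K V} (hx : x ∈ tensorPart K V n) :
    b.envProj x ∈ b.stdFiltration.part n :=
  ⟨x, Submodule.mem_iSup_of_mem n (Submodule.mem_iSup_of_mem le_rfl hx), rfl⟩

theorem prev_sup_map_tensorPart (n : ℕ) :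
    b.stdFiltration.prev n ⊔ (tensorPart K V n).map b.envProj.toLinearMap =
      b.stdFiltration.part n := by
  cases n with
  | zero => simp [AlgFiltration.prev, stdFiltration]
  | succ n =>
    change Submodule.map _ _ ⊔ _ = Submodule.map _ _
    rw [← Submodule.map_sup, ← Nat.iSup_le_succ]

/-- The filtration is exhaustive because `T(V)` is the sum of its homogeneous components. -/
theorem exists_mem_part (x : b.Env) : ∃ n, x ∈ b.stdFiltration.part n := by
  obtain ⟨x, rfl⟩ := Ideal.Quotient.mkₐ_surjective K _ x
  have hx : x ∈ ⨆ n, tensorPart K V n := by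
    rw [show ⨆ n, tensorPart K V n = ⊤ from (DirectSum.Decomposition.isInternal
      fun n => LinearMap.range (TensorAlgebra.ι K : V →ₗ[K] _) ^ n).submodule_iSup_eq_top]
    trivial
  induction hx using Submodule.iSup_induction' with
  | mem n x hx => exact ⟨n, b.envProj_mem_part hx⟩
  | zero => exact ⟨0, by rw [map_zero]; exact zero_mem _⟩
  | add x y _ _ hx hy =>
    obtain ⟨m, hm⟩ := hx
    obtain ⟨n, hn⟩ := hy
    exact ⟨max m n, by
      rw [map_add]
      exact add_mem (b.stdFiltration.mono (le_max_left m n) hm)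
        (b.stdFiltration.mono (le_max_right m n) hn)⟩

/-- On `V^{⊗ n}` the map `ϑ_U` is `π_U` followed by the projection onto `U₍ₙ₎ / U₍ₙ₋₁₎`. -/
theorem theta_apply {n : ℕ} {x : TensorAlgebra K V} (hx : x ∈ tensorPart K V n) :
    b.theta x = DirectSum.of b.stdFiltration.Gr n
      (b.stdFiltration.cls n ⟨b.envProj x, b.envProj_mem_part hx⟩) := by
  induction hx using Submodule.pow_induction_on_left' with
  | algebraMap r =>
    rw [AlgHom.commutes, DirectSum.algebraMap_apply]
    refine DirectSum.of_eq_of_gradedMonoid_eq (b.stdFiltration.gradedMk_ext rfl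
      (x := r • ⟨1, b.stdFiltration.one_mem⟩) ?_)
    simp [Algebra.smul_def]
  | add x y n hx hy ihx ihy =>
    rw [map_add, ihx, ihy, ← map_add, ← map_add]
    congr 2
  | mem_mul m hm n x hx ih =>
    obtain ⟨v, rfl⟩ := hm
    rw [map_mul, ih, theta, TensorAlgebra.lift_ι_apply]
    -- The product lives in degree `1 + n` and the claim in degree `n + 1`. These components are
    -- different types, so the classes are compared in the graded monoid.
    refine (DirectSum.of_mul_of _ _).trans (DirectSum.of_eq_of_gradedMonoid_eq ?_)
    refine b.stdFiltration.gradedMk_ext (m := 1 + n) (n := n + 1) (add_comm _ _)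
      (x := b.stdFiltration.mulPart 1 n ⟨_, b.incl_mem v⟩ ⟨_, b.envProj_mem_part hx⟩) ?_
    exact (map_mul b.envProj (TensorAlgebra.ι K v) x).symm

/-! ### Complements of `U₍ₙ₋₁₎` under the PBW hypothesis. -/

variable {b}

theorem IsPBWType.nicholsProj_eq_zero_iff (hb : b.IsPBWType) {n : ℕ} {x : TensorAlgebra K V}
    (hx : x ∈ tensorPart K V n) :
    nicholsProj c x = 0 ↔ b.envProj x ∈ b.stdFiltration.prev n := by
  obtain ⟨ω, hω, -, h⟩ := hb
  rw [← map_eq_zero_iff ω hω.injective, ← AlgHom.comp_apply, h, b.theta_apply hx,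
    map_eq_zero_iff _ (DirectSum.of_injective n), AlgFiltration.cls_eq_zero_iff]

section

variable {n : ℕ} {W : Submodule K (TensorAlgebra K V)}

/-- If `w` in `W` has the same image as `x` under `Ω`, then `x - w` is killed by `Ω`, so `π_U x` and
`π_U w` differ by an element of `U₍ₙ₋₁₎`. -/
theorem IsPBWType.prev_sup_map (hb : b.IsPBWType) (hW : W ≤ tensorPart K V n)
    (h : Set.SurjOn (nicholsProj c) W (nicholsPart c n)) :
    b.stdFiltration.prev n ⊔ W.map b.envProj.toLinearMap = b.stdFiltration.part n := by
  rw [← b.prev_sup_map_tensorPart]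
  refine le_antisymm (sup_le_sup_left (Submodule.map_mono hW) _) (sup_le le_sup_left ?_)
  rintro _ ⟨x, hx, rfl⟩
  obtain ⟨w, hw, hwx⟩ := h ⟨x, hx, rfl⟩
  have hp : b.envProj (x - w) ∈ b.stdFiltration.prev n :=
    (hb.nicholsProj_eq_zero_iff (sub_mem hx (hW hw))).1 (by
      rw [map_sub, hwx]; exact sub_self _)
  rw [← sub_add_cancel x w, map_add]
  exact Submodule.add_mem_sup hp ⟨w, hw, rfl⟩

/-- Common source of the trivial intersection and of injectivity: the kernel of `π_U` on `W` is
covered because `0` lies in `U₍ₙ₋₁₎`. -/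
theorem IsPBWType.eq_zero_of_envProj_mem_prev (hb : b.IsPBWType) (hW : W ≤ tensorPart K V n)
    (h : Set.InjOn (nicholsProj c) W) {w : TensorAlgebra K V} (hw : w ∈ W)
    (hp : b.envProj w ∈ b.stdFiltration.prev n) : w = 0 :=
  h hw (zero_mem W) (by rw [(hb.nicholsProj_eq_zero_iff (hW hw)).2 hp, map_zero])

theorem IsPBWType.disjoint_prev_map (hb : b.IsPBWType) (hW : W ≤ tensorPart K V n)
    (h : Set.InjOn (nicholsProj c) W) :
    Disjoint (b.stdFiltration.prev n) (W.map b.envProj.toLinearMap) := by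
  rw [Submodule.disjoint_def]
  rintro _ hp ⟨w, hw, rfl⟩
  rw [hb.eq_zero_of_envProj_mem_prev hW h hw hp, map_zero]

theorem IsPBWType.injOn_envProj (hb : b.IsPBWType) (hW : W ≤ tensorPart K V n)
    (h : Set.InjOn (nicholsProj c) W) : Set.InjOn b.envProj W := fun x hx y hy hxy =>
  sub_eq_zero.1 (hb.eq_zero_of_envProj_mem_prev hW h (sub_mem hx hy)
    (by rw [map_sub, hxy, sub_self]; exact zero_mem _))

end

/-! ### The basis of `U`. -/

variable {I : nicholsSupport c → Type*} {v : (n : nicholsSupport c) → I n → TensorAlgebra K V}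

/-- Within one degree, `π_U` is injective on the span of the family; between degrees, the images of
these spans are independent subspaces. -/
theorem IsPBWType.linearIndependent (hb : b.IsPBWType)
    (hv : ∀ (n : nicholsSupport c) (i : I n), v n i ∈ tensorPart K V n)
    (hli : ∀ n : nicholsSupport c, LinearIndependent K (v n))
    (h : ∀ n : nicholsSupport c,
      Set.InjOn (nicholsProj c) (Submodule.span K (Set.range (v n)))) :
    LinearIndependent K fun ni : Σ n : nicholsSupport c, I n => b.envProj (v ni.1 ni.2) := by
  have hW : ∀ n : nicholsSupport c, Submodule.span K (Set.range (v n)) ≤ tensorPart K V n :=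
    fun n => Submodule.span_le.2 (Set.range_subset_iff.2 (hv n))
  have hmap : ∀ n : nicholsSupport c,
      Submodule.span K (Set.range fun i => b.envProj (v n i)) =
        (Submodule.span K (Set.range (v n))).map b.envProj.toLinearMap := fun n => by
    rw [Submodule.map_span, ← Set.range_comp]
    rfl
  have hind : iSupIndep fun n : nicholsSupport c =>
      Submodule.span K (Set.range fun i => b.envProj (v n i)) := by
    simp_rw [hmap]
    exact b.stdFiltration.iSupIndep_of_disjoint_prev
      (fun n => (Submodule.map_mono (hW n)).trans
        (le_sup_right.trans (b.prev_sup_map_tensorPart n).le))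
      fun n => hb.disjoint_prev_map (hW n) (h n)
  exact linearIndependent_iUnion_finite
    (fun n => (hli n).map_injOn b.envProj.toLinearMap (hb.injOn_envProj (hW n) (h n)))
    fun i t _ hi => hind.disjoint_biSup hi

theorem IsPBWType.span_eq_top (hb : b.IsPBWType)
    (hv : ∀ (n : nicholsSupport c) (i : I n), v n i ∈ tensorPart K V n)
    (h : ∀ n : nicholsSupport c,
      Set.SurjOn (nicholsProj c) (Submodule.span K (Set.range (v n))) (nicholsPart c n)) :
    Submodule.span K (Set.range fun ni : Σ n : nicholsSupport c, I n =>
      b.envProj (v ni.1 ni.2)) = ⊤ := by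
  set S := Submodule.span K (Set.range fun ni : Σ n : nicholsSupport c, I n =>
    b.envProj (v ni.1 ni.2))
  -- Stated with `prev`, this serves as base case and inductive step alike, since `prev 0 = ⊥` and
  -- `prev (n + 1) = part n`.
  have hstep : ∀ n, b.stdFiltration.prev n ≤ S → b.stdFiltration.part n ≤ S := by
    intro n hn
    by_cases hΘ : n ∈ nicholsSupport c
    · rw [← hb.prev_sup_map (Submodule.span_le.2 (Set.range_subset_iff.2 (hv ⟨n, hΘ⟩)))
        (h ⟨n, hΘ⟩), Submodule.map_span]
      refine sup_le hn (Submodule.span_mono ?_)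
      rintro _ ⟨_, ⟨i, rfl⟩, rfl⟩
      exact ⟨⟨⟨n, hΘ⟩, i⟩, rfl⟩
    · have hbot : nicholsPart c n = ⊥ := not_not.1 hΘ
      -- Outside the support the zero subspace already maps onto `B(V, c)^n = 0`, so `U₍ₙ₎ = U₍ₙ₋₁₎`
      -- and no basis vectors are needed.
      rw [← hb.prev_sup_map (W := ⊥) bot_le, Submodule.map_bot, sup_bot_eq]
      · exact hn
      · rw [hbot]
        rintro x rfl
        exact ⟨0, rfl, map_zero _⟩
  have hpart : ∀ n, b.stdFiltration.part n ≤ S := fun n => by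
    induction n with
    | zero => exact hstep 0 bot_le
    | succ n ih => exact hstep (n + 1) ih
  refine eq_top_iff.2 fun x _ => ?_
  obtain ⟨n, hn⟩ := b.exists_mem_part x
  exact hpart n hn

end Bracket

end BraidedLie

theorem mainTheorem9 {K V : Type*} [Field K] [AddCommGroup V] [Module K V]
    (c : TensorProduct K V V →ₗ[K] TensorProduct K V V) (hc : BraidedLie.IsBraiding c)
    (b : BraidedLie.Bracket c) (hLie : b.IsBraidedLie) (hPBW : b.IsPBWType) :
    (∀ (n : ℕ) (W : Submodule K (TensorAlgebra K V)), W ≤ BraidedLie.tensorPart K V n →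
      Set.BijOn (BraidedLie.nicholsProj c) W (BraidedLie.nicholsPart c n) →
      b.stdFiltration.prev n ⊔ W.map b.envProj.toLinearMap = b.stdFiltration.part n ∧
      Disjoint (b.stdFiltration.prev n) (W.map b.envProj.toLinearMap) ∧
      Set.InjOn b.envProj W) ∧
    (∀ (I : BraidedLie.nicholsSupport c → Type*)
      (v : (n : BraidedLie.nicholsSupport c) → I n → TensorAlgebra K V),
      (∀ (n : BraidedLie.nicholsSupport c) (i : I n), v n i ∈ BraidedLie.tensorPart K V n) →
      (∀ n : BraidedLie.nicholsSupport c, LinearIndependent K (v n)) →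
      (∀ n : BraidedLie.nicholsSupport c, Set.BijOn (BraidedLie.nicholsProj c)
        (Submodule.span K (Set.range (v n))) (BraidedLie.nicholsPart c n)) →
      ∃ e : Module.Basis (Σ n : BraidedLie.nicholsSupport c, I n) K b.Env,
        ∀ (n : BraidedLie.nicholsSupport c) (i : I n), e ⟨n, i⟩ = b.envProj (v n i)) := by
  refine ⟨fun n W hW h => ⟨hPBW.prev_sup_map hW h.surjOn, hPBW.disjoint_prev_map hW h.injOn,
    hPBW.injOn_envProj hW h.injOn⟩, fun I v hv hli h => ?_⟩
  refine ⟨Module.Basis.mk (hPBW.linearIndependent hv hli fun n => (h n).injOn)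
    (hPBW.span_eq_top hv fun n => (h n).surjOn).ge, fun n i => ?_⟩
  rw [Module.Basis.mk_apply]
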